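/- Alice and Bob play a game in which they take turns, Alice starting, until each has made $n$ moves; each move is a choice between two possibilities. In the game $\mathrm{Ab}_n(p)$, the outcome is determined by the whole history of Alice's moves together with the number of times Bob has played each of his two possible moves, so that there are $2^n(n+1)$ possible outcomes. In the game $\mathrm{ab}_n(p)$, the outcome is determined by the numbers of times Alice and Bob have each played each of their two possible moves, so that there are $(n+1)^2$ possible outcomes. (The states of the game record in the same way what is relevant of the moves made so far, and a pure strategy of a player assigns a move to each state in which it is that player's turn.) Before the game starts, a winner is assigned independently to each possible outcome: Bob with probability $p\in[0,1]$ and Alice with probability $1-p$; both players know this assignment. Let $P^{\mathrm{Ab}}_n(p)$ and $P^{\mathrm{ab}}_n(p)$ denote the probabilities that Bob has a winning strategy in the games $\mathrm{Ab}_n(p)$ and $\mathrm{ab}_n(p)$. Then for each $n\geq 1$ and $p\in[0,1]$, the probabilities that Alice has a winning strategy in the games $\mathrm{Ab}_n(p)$ and $\mathrm{ab}_n(p)$ are equal to $1-P^{\mathrm{Ab}}_n(p)$ and $1-P^{\mathrm{ab}}_n(p)$, respectively, and they satisfy $$1-P^{\mathrm{Ab}}_n(p)\leq\sum_{m=n}^\infty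 2^{3m}(1-p)^{m+1}\qquad\text{and}\qquad 1-P^{\mathrm{ab}}_n(p)\leq\sum_{m=n}^\infty 2^{4m}(1-p)^{m+1},$$ where the sums take values in $[0,\infty]$. In particular, $P^{\mathrm{Ab}}_n(p)\to 1$ as $n\to\infty$ for all $p\in(7/8,1]$, and $P^{\mathrm{ab}}_n(p)\to 1$ as $n\to\infty$ for all $p\in(15/16,1]$. -/

import Mathlib

open MeasureTheory ProbabilityTheory

/-- The two players. -/
inductive Player
  | alice
  | bob

/-- The graph structure of a finite turn-based two-player game: a finite acyclic directed graph
of game states with a root from which every state can be reached, and a function that says whose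
turn it is in each non-final state (a state is final if it has no outgoing edge). -/
structure GameGraph where
  V : Type
  Adj : V → V → Prop
  root : V
  finite : Finite V
  acyclic : ∀ v, ¬ Relation.TransGen Adj v v
  reach : ∀ v, Relation.ReflTransGen Adj root v
  turn : {v : V // ∃ w, Adj v w} → Player

namespace GameGraph

variable (G : GameGraph)

/-- The non-final states. -/
abbrev Interior : Type := {v : G.V // ∃ w, G.Adj v w}

/-- The final states, that is, the possible outcomes of the game. -/
abbrev Outcome : Type := {v : G.V // ¬ ∃ w, G.Adj v w}

/-- A pure strategy for player `P`: a choice of an outgoing edge in each non-final state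
in which it is the turn of `P`. -/
abbrev Strategy (P : Player) : Type :=
  (v : G.Interior) → G.turn v = P → {w : G.V // G.Adj v.1 w}

/-- The state that follows the non-final state `v`, given the strategies of both players. -/
def next (s₁ : G.Strategy .alice) (s₂ : G.Strategy .bob) (v : G.Interior) :
    {w : G.V // G.Adj v.1 w} :=
  match h : G.turn v with
  | .alice => s₁ v h
  | .bob => s₂ v h

theorem wellFounded_adj : WellFounded (fun w v : G.V => G.Adj v w) := by
  have := G.finite
  have : IsTrans G.V (fun w v => Relation.TransGen G.Adj v w) :=
    ⟨fun _ _ _ h₁ h₂ => Relation.TransGen.trans h₂ h₁⟩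
  have : Std.Irrefl (fun w v => Relation.TransGen G.Adj v w) := ⟨G.acyclic⟩
  exact Subrelation.wf (fun h => Relation.TransGen.single h)
    (Finite.wellFounded_of_trans_of_irrefl (fun w v => Relation.TransGen G.Adj v w))

open Classical in
/-- The final state in which the play that starts in `v` ends, given the strategies of both
players. -/
noncomputable def outcomeFrom (s₁ : G.Strategy .alice) (s₂ : G.Strategy .bob) :
    G.V → G.Outcome :=
  G.wellFounded_adj.fix fun v ih =>
    if h : ∃ w, G.Adj v w then
      ih (G.next s₁ s₂ ⟨v, h⟩).1 (G.next s₁ s₂ ⟨v, h⟩).2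
    else ⟨v, h⟩

/-- The outcome of the game, given the strategies of both players. -/
noncomputable def outcome (s₁ : G.Strategy .alice) (s₂ : G.Strategy .bob) : G.Outcome :=
  G.outcomeFrom s₁ s₂ G.root

/-- Alice has a winning strategy given the assignment `x` of winners to possible outcomes,
where `false` means that Alice is the winner and `true` means that Bob is the winner. -/
def AliceWins (x : G.Outcome → Bool) : Prop :=
  ∃ s₁ : G.Strategy .alice, ∀ s₂ : G.Strategy .bob, x (G.outcome s₁ s₂) = false

/-- Bob has a winning strategy given the assignment `x` of winners to possible outcomes. -/
def BobWins (x : G.Outcome → Bool) : Prop :=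
  ∃ s₂ : G.Strategy .bob, ∀ s₁ : G.Strategy .alice, x (G.outcome s₁ s₂) = true

/-- The law of the random assignment of winners in which, independently for each possible outcome,
Bob is the winner with probability `p` and Alice is the winner with probability `1 - p`. -/
noncomputable def winnerLaw (p : unitInterval) : Measure (G.Outcome → Bool) :=
  haveI := G.finite
  haveI : Fintype G.Outcome := Fintype.ofFinite _
  Measure.pi fun _ => bernoulliMeasure true false p

/-- The probability that Alice has a winning strategy. -/
noncomputable def probAlice (p : unitInterval) : ℝ := (G.winnerLaw p).real {x | G.AliceWins x}

/-- The probability that Bob has a winning strategy. -/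
noncomputable def probBob (p : unitInterval) : ℝ := (G.winnerLaw p).real {x | G.BobWins x}

end GameGraph

/-- A (locally finite) decision graph: a directed graph with a root from which every vertex can be
reached, in which every edge increases the distance `len` from the root by exactly one, and in
which every vertex has an outgoing edge. The laws force `len v` to be the length of every path
from the root to `v`, hence the graph distance. -/
structure DecisionGraph where
  V : Type
  Adj : V → V → Prop
  root : V
  len : V → ℕ
  reach : ∀ v, Relation.ReflTransGen Adj root v
  len_root : len root = 0
  len_succ : ∀ {v w}, Adj v w → len w = len v + 1
  exists_adj : ∀ v, ∃ w, Adj v w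
  finite_adj : ∀ v, {w | Adj v w}.Finite

namespace DecisionGraph

theorem eq_root_of_len (D : DecisionGraph) {v : D.V} (h : D.len v = 0) : v = D.root := by
  rcases Relation.ReflTransGen.cases_tail (D.reach v) with h' | ⟨u, -, hu⟩
  · exact h'
  · have := D.len_succ hu
    omega

theorem exists_pred (D : DecisionGraph) {v : D.V} {k : ℕ} (h : D.len v = k + 1) :
    ∃ u, D.Adj u v ∧ D.len u = k := by
  rcases Relation.ReflTransGen.cases_tail (D.reach v) with h' | ⟨u, -, hu⟩
  · rw [h', D.len_root] at h
    omega
  · have := D.len_succ hu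
    exact ⟨u, hu, by omega⟩

theorem finite_len_le (D : DecisionGraph) (N : ℕ) : {v | D.len v ≤ N}.Finite := by
  induction N with
  | zero =>
    refine (Set.finite_singleton D.root).subset fun v hv => ?_
    exact D.eq_root_of_len (Nat.le_zero.mp hv)
  | succ k ih =>
    refine (ih.union (ih.biUnion fun v _ => D.finite_adj v)).subset fun v hv => ?_
    rcases Nat.lt_or_ge (D.len v) (k + 1) with h | h
    · exact Or.inl (Nat.lt_succ_iff.mp h)
    · obtain ⟨u, hu, hk⟩ := D.exists_pred (le_antisymm hv h)
      exact Or.inr (Set.mem_biUnion (show u ∈ {v | D.len v ≤ k} from hk.le) hu)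

/-- The game in which the players play `N` moves together on the decision graph `D`, taking turns,
where Alice starts. -/
def game (D : DecisionGraph) (N : ℕ) : GameGraph where
  V := {v : D.V // D.len v ≤ N}
  Adj v w := D.Adj v.1 w.1
  root := ⟨D.root, by rw [D.len_root]; exact N.zero_le⟩
  finite := (D.finite_len_le N).to_subtype
  acyclic v h := by
    have key : ∀ w : {v : D.V // D.len v ≤ N},
        Relation.TransGen (fun v w : {v : D.V // D.len v ≤ N} => D.Adj v.1 w.1) v w →
          D.len v.1 < D.len w.1 := by
      intro w hw
      induction hw with
      | single h => have := D.len_succ h; omega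
      | tail _ h ih => have := D.len_succ h; omega
    exact lt_irrefl _ (key v h)
  reach := by
    rintro ⟨v, hv⟩
    induction D.reach v with
    | refl => exact Relation.ReflTransGen.refl
    | tail _ h ih =>
      have := D.len_succ h
      exact Relation.ReflTransGen.tail (ih (by omega)) h
  turn v := if Even (D.len v.1.1) then Player.alice else Player.bob

/-- The binary tree: the vertices are the finite words over a two-letter alphabet, and the edges
lead from a word to the two words that one gets by appending a letter. It records the whole
history of the moves of a player. -/
def tree : DecisionGraph where
  V := List Bool
  Adj v w := ∃ k : Bool, w = v ++ [k]
  root := []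
  len v := v.length
  reach v := by
    induction v using List.reverseRecOn with
    | nil => exact Relation.ReflTransGen.refl
    | append_singleton v k ih => exact Relation.ReflTransGen.tail ih ⟨k, rfl⟩
  len_root := rfl
  len_succ := by
    rintro v w ⟨k, rfl⟩
    simp
  exists_adj v := ⟨v ++ [true], true, rfl⟩
  finite_adj v := (Set.finite_range fun k : Bool => v ++ [k]).subset (by
    rintro w ⟨k, rfl⟩
    exact ⟨k, rfl⟩)

/-- The quadrant `ℕ²`, with edges from `(i, j)` to `(i + 1, j)` and to `(i, j + 1)`. It records
only how often a player has played each of the two possible moves. -/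
def quadrant : DecisionGraph where
  V := ℕ × ℕ
  Adj v w := w = (v.1 + 1, v.2) ∨ w = (v.1, v.2 + 1)
  root := (0, 0)
  len v := v.1 + v.2
  reach := by
    rintro ⟨i, j⟩
    induction j with
    | zero =>
      induction i with
      | zero => exact Relation.ReflTransGen.refl
      | succ i ih => exact Relation.ReflTransGen.tail ih (Or.inl rfl)
    | succ j ih => exact Relation.ReflTransGen.tail ih (Or.inr rfl)
  len_root := rfl
  len_succ := by
    rintro v w (rfl | rfl) <;> simp only <;> omega
  exists_adj v := ⟨_, Or.inl rfl⟩
  finite_adj v := ({(v.1 + 1, v.2), (v.1, v.2 + 1)} : Set (ℕ × ℕ)).toFinite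

/-- The product of two decision graphs: the states are pairs `(a, b)`, where `a` and `b` record
what is relevant of the moves of Alice and of Bob, and `a` and `b` are replaced in turns,
beginning with `a`. -/
def ltimes (D₁ D₂ : DecisionGraph) : DecisionGraph where
  V := {v : D₁.V × D₂.V // D₁.len v.1 = D₂.len v.2 ∨ D₁.len v.1 = D₂.len v.2 + 1}
  Adj v w :=
    (D₁.len v.1.1 = D₂.len v.1.2 ∧ D₁.Adj v.1.1 w.1.1 ∧ w.1.2 = v.1.2) ∨
    (D₁.len v.1.1 = D₂.len v.1.2 + 1 ∧ w.1.1 = v.1.1 ∧ D₂.Adj v.1.2 w.1.2)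
  root := ⟨(D₁.root, D₂.root), Or.inl (by rw [D₁.len_root, D₂.len_root])⟩
  len v := D₁.len v.1.1 + D₂.len v.1.2
  reach := by
    have key : ∀ (k : ℕ)
        (v : {v : D₁.V × D₂.V // D₁.len v.1 = D₂.len v.2 ∨ D₁.len v.1 = D₂.len v.2 + 1}),
        D₁.len v.1.1 + D₂.len v.1.2 = k → Relation.ReflTransGen
          (fun v w : {v : D₁.V × D₂.V // D₁.len v.1 = D₂.len v.2 ∨
              D₁.len v.1 = D₂.len v.2 + 1} =>
            (D₁.len v.1.1 = D₂.len v.1.2 ∧ D₁.Adj v.1.1 w.1.1 ∧ w.1.2 = v.1.2) ∨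
            (D₁.len v.1.1 = D₂.len v.1.2 + 1 ∧ w.1.1 = v.1.1 ∧ D₂.Adj v.1.2 w.1.2))
          ⟨(D₁.root, D₂.root), Or.inl (by rw [D₁.len_root, D₂.len_root])⟩ v := by
      intro k
      induction k with
      | zero =>
        rintro ⟨⟨a, b⟩, h⟩ hk
        obtain rfl := D₁.eq_root_of_len (v := a) (by simp only at hk; omega)
        obtain rfl := D₂.eq_root_of_len (v := b) (by simp only at hk; omega)
        exact Relation.ReflTransGen.refl
      | succ k ih =>
        rintro ⟨⟨a, b⟩, h⟩ hk
        simp only at h hk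
        rcases h with h | h
        · obtain ⟨m, hm⟩ : ∃ m, D₂.len b = m + 1 := ⟨D₂.len b - 1, by omega⟩
          obtain ⟨u, hu, hl⟩ := D₂.exists_pred hm
          refine Relation.ReflTransGen.tail
            (ih ⟨(a, u), Or.inr (by simp only; omega)⟩ (by simp only; omega)) (Or.inr ?_)
          exact ⟨by simp only; omega, rfl, hu⟩
        · obtain ⟨u, hu, hl⟩ := D₁.exists_pred h
          refine Relation.ReflTransGen.tail
            (ih ⟨(u, b), Or.inl hl⟩ (by simp only; omega)) (Or.inl ?_)
          exact ⟨hl, hu, rfl⟩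
    exact fun v => key _ v rfl
  len_root := by simp only [D₁.len_root, D₂.len_root]
  len_succ := by
    rintro ⟨⟨a, b⟩, h⟩ ⟨⟨a', b'⟩, h'⟩ (⟨_, h₁, h₂⟩ | ⟨_, h₁, h₂⟩)
    · simp only at h₁ h₂
      have := D₁.len_succ h₁
      subst h₂
      simp only
      omega
    · simp only at h₁ h₂
      have := D₂.len_succ h₂
      subst h₁
      simp only
      omega
  exists_adj := by
    rintro ⟨⟨a, b⟩, h | h⟩
    · obtain ⟨a', ha⟩ := D₁.exists_adj a
      have := D₁.len_succ ha
      simp only at h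
      exact ⟨⟨(a', b), Or.inr (by simp only; omega)⟩, Or.inl ⟨h, ha, rfl⟩⟩
    · obtain ⟨b', hb⟩ := D₂.exists_adj b
      have := D₂.len_succ hb
      simp only at h
      exact ⟨⟨(a, b'), Or.inl (by simp only; omega)⟩, Or.inr ⟨h, rfl, hb⟩⟩
  finite_adj := by
    rintro ⟨⟨a, b⟩, h⟩
    refine Set.Finite.of_finite_image (f := Subtype.val) ?_ Subtype.val_injective.injOn
    refine (((D₁.finite_adj a).prod (Set.finite_singleton b)).union
      ((Set.finite_singleton a).prod (D₂.finite_adj b))).subset ?_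
    rintro _ ⟨⟨⟨a', b'⟩, h'⟩, ⟨_, h₁, h₂⟩ | ⟨_, h₁, h₂⟩, rfl⟩
    · exact Or.inl ⟨h₁, h₂⟩
    · exact Or.inr ⟨h₁, h₂⟩

end DecisionGraph

/-- The game `Ab_n`: Alice and Bob in turns play `n` moves each, Alice starts, and the outcome is
determined by the whole history of the moves of Alice and by how often Bob has played each of the
two possible moves. -/
def gameAb (n : ℕ) : GameGraph :=
  (DecisionGraph.ltimes DecisionGraph.tree DecisionGraph.quadrant).game (2 * n)

/-- The game `ab_n`: Alice and Bob in turns play `n` moves each, Alice starts, and the outcome is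
determined by how often each of the players has played each of the two possible moves. -/
def gameab (n : ℕ) : GameGraph :=
  (DecisionGraph.ltimes DecisionGraph.quadrant DecisionGraph.quadrant).game (2 * n)

/-! This is a Peierls argument. Give an outcome as height the number of times Bob played his first
move. If Alice can force a win, then some sequence of outcomes, all won by Alice, leads from height
`n` to height zero. It is built by backward recursion (`AliceWinsAt.exists_contour`): after a good
move of Alice both replies of Bob are winning for her, and the contours below the two replies are
concatenated.

At such a junction `b` rounds remain, the height changes by `b - 1`, and the two histories of Alice
agree up to `b` levels before the end. So an outcome has at most `c ^ b` successors of this type,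
with `c = 2` for the tree and `c = 4` for the quadrant. Weighting outcomes by `(1 / (2 * c)) ^
height` shows that at most `(4 * c) ^ m` contours have `m` steps (`sum_card_pathsToZero_le`).
Heights drop by at most one per step, so `m ≥ n`. After loop erasure a contour visits `m + 1`
distinct outcomes, all won by Alice with probability `(1 - p) ^ (m + 1)`, and a union bound gives
the series. Finite games are determined, which gives the statement on Alice's probability. -/

/-! ### Counting paths that descend to height zero -/

section SelfAvoidingPaths

variable {O : Type*} [Fintype O] (h : O → ℕ) (R : O → O → Prop)

open Classical in
/-- The `R`-paths with `m` steps from a given point to a point of height zero, recorded as the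
lists of the points that they visit. -/
noncomputable def pathsToZero : ℕ → O → Finset (List O)
  | 0, x => if h x = 0 then {[x]} else ∅
  | m + 1, x => (Finset.univ.filter (R x)).biUnion fun y => (pathsToZero m y).image (x :: ·)

variable {h R}

theorem mem_pathsToZero_zero {x : O} {l : List O} :
    l ∈ pathsToZero h R 0 x ↔ h x = 0 ∧ l = [x] := by
  by_cases hx : h x = 0 <;> simp [pathsToZero, hx]

theorem mem_pathsToZero_succ {m : ℕ} {x : O} {l : List O} :
    l ∈ pathsToZero h R (m + 1) x ↔ ∃ y, R x y ∧ ∃ l' ∈ pathsToZero h R m y, x :: l' = l := by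
  simp [pathsToZero]

theorem length_of_mem_pathsToZero {m : ℕ} {x : O} {l : List O} (hl : l ∈ pathsToZero h R m x) :
    l.length = m + 1 := by
  induction m generalizing x l with
  | zero => simp [(mem_pathsToZero_zero.1 hl).2]
  | succ m ih =>
    obtain ⟨y, -, l', hl', rfl⟩ := mem_pathsToZero_succ.1 hl
    simp [ih hl']

theorem height_le_of_mem_pathsToZero (hR : ∀ x y, R x y → h x ≤ h y + 1) {m : ℕ} {x : O}
    {l : List O} (hl : l ∈ pathsToZero h R m x) : h x ≤ m := by
  induction m generalizing x l with
  | zero => exact (mem_pathsToZero_zero.1 hl).1.le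
  | succ m ih =>
    obtain ⟨y, hxy, l', hl', rfl⟩ := mem_pathsToZero_succ.1 hl
    exact (hR x y hxy).trans (Nat.succ_le_succ (ih hl'))

theorem exists_suffix_mem_pathsToZero {m : ℕ} {x y : O} {l : List O}
    (hl : l ∈ pathsToZero h R m x) (hy : y ∈ l) :
    ∃ m', ∃ l' ∈ pathsToZero h R m' y, l' <:+ l := by
  induction m generalizing x l with
  | zero =>
    obtain ⟨hx, rfl⟩ := mem_pathsToZero_zero.1 hl
    obtain rfl := List.mem_singleton.1 hy
    exact ⟨0, _, hl, List.suffix_rfl⟩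
  | succ m ih =>
    obtain ⟨z, hxz, l', hl', rfl⟩ := mem_pathsToZero_succ.1 hl
    rcases List.mem_cons.1 hy with rfl | hy
    · exact ⟨m + 1, _, hl, List.suffix_rfl⟩
    · obtain ⟨m', l'', h₁, h₂⟩ := ih hl' hy
      exact ⟨m', l'', h₁, h₂.trans (List.suffix_cons _ _)⟩

/-- Loop erasure. -/
theorem exists_nodup_mem_pathsToZero {A : O → Prop} {x z : O}
    (hxz : Relation.ReflTransGen (fun u v => R u v ∧ A u) x z) (hz : h z = 0) (hA : A z) :
    ∃ m, ∃ l ∈ pathsToZero h R m x, l.Nodup ∧ ∀ o ∈ l, A o := by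
  induction hxz using Relation.ReflTransGen.head_induction_on with
  | refl => exact ⟨0, [z], mem_pathsToZero_zero.2 ⟨hz, rfl⟩, by simp, by simpa⟩
  | @head x y hxy _ ih =>
    obtain ⟨m, l, hl, hnd, hlA⟩ := ih
    by_cases hx : x ∈ l
    -- The path returns to `x`: the loop is cut by keeping only the part that starts at the visit to
    -- `x`.
    · obtain ⟨m', l', h₁, h₂⟩ := exists_suffix_mem_pathsToZero hl hx
      exact ⟨m', l', h₁, hnd.sublist h₂.sublist, fun o ho => hlA o (h₂.subset ho)⟩
    · refine ⟨m + 1, x :: l, mem_pathsToZero_succ.2 ⟨y, hxy.1, l, hl, rfl⟩,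
        List.nodup_cons.2 ⟨hx, hnd⟩, ?_⟩
      rintro o (_ | ⟨_, ho⟩)
      exacts [hxy.2, hlA o ‹_›]

-- With `r = 1 / (2 * c)`, the successors of increment `b - 1` contribute at most `r ^ (h x - 1) *
-- (c * r) ^ b`, a geometric series of ratio `1 / 2`. This `r` maximizes `r * (1 - c * r)`, hence
-- gives the smallest factor, `4 * c`.
open Classical in
theorem sum_pow_height_le {c : ℕ} (hc : 0 < c) (hR : ∀ x y, R x y → h x ≤ h y + 1)
    (hcard : ∀ x b, (Finset.univ.filter fun y => R x y ∧ h y + 1 = h x + b).card ≤ c ^ b) (x : O) :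
    ∑ y ∈ Finset.univ.filter (R x), (1 / (2 * c : ℝ)) ^ h y
      ≤ 4 * c * (1 / (2 * c : ℝ)) ^ h x := by
  have hc' : (0 : ℝ) < c := by exact_mod_cast hc
  set r : ℝ := 1 / (2 * c) with hr
  have hr0 : 0 < r := by positivity
  set B := ((Finset.univ : Finset O).sup h) + 2
  have hB : ∀ y ∈ Finset.univ.filter (R x), h y + 1 - h x ∈ Finset.range B := fun y _ => by
    have : h y ≤ Finset.univ.sup h := Finset.le_sup (Finset.mem_univ y)
    simp only [Finset.mem_range, B]
    omega
  -- The exponent is shifted by one because `h x - 1` would be truncated at `h x = 0`.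
  have key : ∑ y ∈ Finset.univ.filter (R x), r ^ (h y + 1) ≤ 2 * r ^ h x := by
    rw [← Finset.sum_fiberwise_of_maps_to hB]
    calc _ ≤ ∑ b ∈ Finset.range B, r ^ h x * (1 / 2 : ℝ) ^ b := by
          refine Finset.sum_le_sum fun b _ => ?_
          have hfil : (Finset.univ.filter (R x)).filter (fun y => h y + 1 - h x = b)
              = Finset.univ.filter fun y => R x y ∧ h y + 1 = h x + b := by
            ext y
            simp only [Finset.mem_filter, Finset.mem_univ, true_and]
            -- By `hR` the natural subtraction `h y + 1 - h x` is exact.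
            refine and_congr_right fun hxy => ?_
            have := hR x y hxy
            omega
          rw [hfil]
          calc _ = ∑ y ∈ Finset.univ.filter fun y => R x y ∧ h y + 1 = h x + b,
                r ^ (h x + b) := Finset.sum_congr rfl fun y hy => by
                  rw [(Finset.mem_filter.1 hy).2.2]
            _ ≤ (c : ℝ) ^ b * r ^ (h x + b) := by
              rw [Finset.sum_const, nsmul_eq_mul]
              gcongr
              exact_mod_cast hcard x b
            _ = r ^ h x * (c * r) ^ b := by ring
            _ = r ^ h x * (1 / 2) ^ b := by
              congr 2
              rw [hr]
              field_simp
      _ ≤ r ^ h x * 2 := by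
          rw [← Finset.mul_sum]
          gcongr
          exact sum_geometric_two_le B
      _ = _ := mul_comm _ _
  have e : ∑ y ∈ Finset.univ.filter (R x), r ^ (h y + 1)
      = (∑ y ∈ Finset.univ.filter (R x), r ^ h y) * r := by
    rw [Finset.sum_mul]
    simp only [pow_succ]
  rw [e, ← le_div_iff₀ hr0] at key
  refine key.trans_eq ?_
  rw [hr]
  field_simp
  ring

/-- Induction on the first step: each step multiplies the weight by at most `4 * c`, and at height
zero the weight is one. -/
theorem card_pathsToZero_le {c : ℕ} (hc : 0 < c) (hR : ∀ x y, R x y → h x ≤ h y + 1)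
    (hcard : ∀ x b, {y | R x y ∧ h y + 1 = h x + b}.ncard ≤ c ^ b) (m : ℕ) (x : O) :
    ((pathsToZero h R m x).card : ℝ) ≤ (4 * c) ^ m * (1 / (2 * c : ℝ)) ^ h x := by
  classical
  have hcard' : ∀ x b, (Finset.univ.filter fun y => R x y ∧ h y + 1 = h x + b).card ≤ c ^ b :=
    fun x b => by
      rw [← Set.ncard_coe_finset]
      simpa using hcard x b
  induction m generalizing x with
  | zero =>
    by_cases hx : h x = 0
    · simp [pathsToZero, hx]
    · simp only [pathsToZero, hx, if_false, Finset.card_empty, Nat.cast_zero]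
      positivity
  | succ m ih =>
    calc ((pathsToZero h R (m + 1) x).card : ℝ)
        ≤ ∑ y ∈ Finset.univ.filter (R x), ((pathsToZero h R m y).card : ℝ) := by
          rw [pathsToZero]
          exact_mod_cast Finset.card_biUnion_le.trans
            (Finset.sum_le_sum fun y _ => Finset.card_image_le)
      _ ≤ ∑ y ∈ Finset.univ.filter (R x), (4 * c : ℝ) ^ m * (1 / (2 * c : ℝ)) ^ h y :=
          Finset.sum_le_sum fun y _ => ih y
      _ ≤ (4 * c) ^ m * (4 * c * (1 / (2 * c : ℝ)) ^ h x) := by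
          rw [← Finset.mul_sum]
          gcongr
          exact sum_pow_height_le hc hR hcard' x
      _ = _ := by ring

/-- The weight `(1 / (2 * c)) ^ n` more than compensates for the `c ^ n` starting points; the
remaining factor `(1 / 2) ^ n` is discarded. -/
theorem sum_card_pathsToZero_le {c n : ℕ} (hc : 0 < c) (hR : ∀ x y, R x y → h x ≤ h y + 1)
    (hcard : ∀ x b, {y | R x y ∧ h y + 1 = h x + b}.ncard ≤ c ^ b) (S : Finset O)
    (hS : ∀ x ∈ S, h x = n) (hScard : S.card ≤ c ^ n) (m : ℕ) :
    ∑ x ∈ S, (pathsToZero h R m x).card ≤ (4 * c) ^ m := by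
  have hc' : (0 : ℝ) < c := by exact_mod_cast hc
  have : ∑ x ∈ S, ((pathsToZero h R m x).card : ℝ) ≤ (4 * c) ^ m :=
    calc _ ≤ ∑ x ∈ S, (4 * c : ℝ) ^ m * (1 / (2 * c : ℝ)) ^ n :=
          Finset.sum_le_sum fun x hx => hS x hx ▸ card_pathsToZero_le hc hR hcard m x
      _ ≤ (c : ℝ) ^ n * ((4 * c : ℝ) ^ m * (1 / (2 * c : ℝ)) ^ n) := by
          rw [Finset.sum_const, nsmul_eq_mul]
          gcongr
          exact_mod_cast hScard
      _ = (4 * c) ^ m * (1 / 2) ^ n := by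
          rw [mul_left_comm, ← mul_pow]
          congr 2
          field_simp
      _ ≤ (4 * c) ^ m * 1 := by
          gcongr
          exact pow_le_one₀ (by norm_num) (by norm_num)
      _ = _ := mul_one _
  exact_mod_cast this

end SelfAvoidingPaths

/-! ### The Peierls bound for independent assignments -/

section Peierls

variable {O : Type*} [Fintype O]

theorem pi_bernoulli_forall_false (p : unitInterval) (s : Finset O) :
    Measure.pi (fun _ : O => bernoulliMeasure true false p) {x | ∀ o ∈ s, x o = false}
      = ENNReal.ofReal ((1 - (p : ℝ)) ^ s.card) := by
  classical
  have e : {x : O → Bool | ∀ o ∈ s, x o = false}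
      = Set.univ.pi fun o => if o ∈ s then {false} else Set.univ := by
    ext x
    simp only [Set.mem_ofPred_eq, Set.mem_univ_pi]
    refine forall_congr' fun o => ?_
    by_cases ho : o ∈ s <;> simp [ho]
  have hf : bernoulliMeasure true false p {false} = ENNReal.ofReal (1 - (p : ℝ)) := by
    rw [bernoulliMeasure_apply_of_notMem_of_mem p (MeasurableSet.singleton _) (by simp) (by simp),
      ENNReal.ofReal, ENNReal.coe_inj]
    exact NNReal.eq (Real.coe_toNNReal _ (by linarith [p.2.2])).symm
  rw [e, Measure.pi_pi]
  have : ∀ o, bernoulliMeasure true false p (if o ∈ s then {false} else Set.univ)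
      = if o ∈ s then ENNReal.ofReal (1 - (p : ℝ)) else 1 := fun o => by
    split_ifs
    · exact hf
    · exact measure_univ
  simp only [this, Finset.prod_ite_mem, Finset.univ_inter, Finset.prod_const]
  rw [ENNReal.ofReal_pow (by linarith [p.2.2])]

/-- A Peierls bound: if the points of height `n` are at most `c ^ n` in number, and every point has
at most `c ^ b` successors whose height is larger by `b - 1`, then a path of points with the value
`false` from height `n` to height zero is unlikely. -/
theorem pi_bernoulli_exists_path_le {h : O → ℕ} {R : O → O → Prop} {c n : ℕ} (hc : 0 < c)
    (hR : ∀ x y, R x y → h x ≤ h y + 1)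
    (hcard : ∀ x b, {y | R x y ∧ h y + 1 = h x + b}.ncard ≤ c ^ b)
    (hn : {x | h x = n}.ncard ≤ c ^ n) (p : unitInterval) (E : Set (O → Bool))
    (hE : ∀ x ∈ E, ∃ u v, h u = n ∧ h v = 0 ∧ x v = false ∧
      Relation.ReflTransGen (fun u v => R u v ∧ x u = false) u v) :
    Measure.pi (fun _ : O => bernoulliMeasure true false p) E ≤
      ∑' m : {m : ℕ // n ≤ m},
        ENNReal.ofReal ((4 * c : ℝ) ^ (m : ℕ) * (1 - (p : ℝ)) ^ ((m : ℕ) + 1)) := by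
  classical
  set μ := Measure.pi (fun _ : O => bernoulliMeasure true false p)
  set S : Finset O := Finset.univ.filter fun x => h x = n
  have hScard : S.card ≤ c ^ n := by
    rw [← Set.ncard_coe_finset]
    simpa [S] using hn
  have hsub : E ⊆ ⋃ m : {m : ℕ // n ≤ m}, ⋃ u ∈ S,
      ⋃ l ∈ (pathsToZero h R m u).filter List.Nodup, {x | ∀ o ∈ l.toFinset, x o = false} := by
    intro x hx
    obtain ⟨u, v, hu, hv, hxv, huv⟩ := hE x hx
    obtain ⟨m, l, hl, hnd, hlx⟩ := exists_nodup_mem_pathsToZero huv hv hxv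
    have hnm : n ≤ m := hu ▸ height_le_of_mem_pathsToZero hR hl
    simp only [Set.mem_iUnion]
    exact ⟨⟨m, hnm⟩, u, by simpa [S] using hu, l, by simp [hl, hnd], by simpa using hlx⟩
  refine (measure_mono hsub).trans ((measure_iUnion_le _).trans (ENNReal.tsum_le_tsum fun m => ?_))
  have hq : 0 ≤ 1 - (p : ℝ) := by linarith [p.2.2]
  calc _ ≤ ∑ u ∈ S, ∑ l ∈ (pathsToZero h R m u).filter List.Nodup,
        μ {x | ∀ o ∈ l.toFinset, x o = false} :=
        (measure_biUnion_finset_le _ _).trans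
          (Finset.sum_le_sum fun u _ => measure_biUnion_finset_le _ _)
    _ = ∑ u ∈ S, ∑ l ∈ (pathsToZero h R m u).filter List.Nodup,
        ENNReal.ofReal ((1 - (p : ℝ)) ^ ((m : ℕ) + 1)) := by
        refine Finset.sum_congr rfl fun u _ => Finset.sum_congr rfl fun l hl => ?_
        -- Without repetitions the list fixes exactly `m + 1` independent coordinates.
        obtain ⟨hl, hnd⟩ := Finset.mem_filter.1 hl
        rw [pi_bernoulli_forall_false, List.toFinset_card_of_nodup hnd,
          length_of_mem_pathsToZero hl]
    _ ≤ ∑ u ∈ S, ((pathsToZero h R m u).card : ENNReal) *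
        ENNReal.ofReal ((1 - (p : ℝ)) ^ ((m : ℕ) + 1)) := by
        refine Finset.sum_le_sum fun u _ => ?_
        rw [Finset.sum_const, nsmul_eq_mul]
        gcongr
        exact Finset.filter_subset _ _
    _ ≤ ((4 * c) ^ (m : ℕ) : ℕ) * ENNReal.ofReal ((1 - (p : ℝ)) ^ ((m : ℕ) + 1)) := by
        rw [← Finset.sum_mul, ← Nat.cast_sum]
        gcongr
        exact sum_card_pathsToZero_le hc hR hcard S (fun x hx => (Finset.mem_filter.1 hx).2)
          hScard m
    _ = _ := by
        rw [ENNReal.ofReal_mul (by positivity), ← ENNReal.ofReal_natCast]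
        push_cast
        rfl

end Peierls

/-! ### Determinacy by backward induction -/

namespace GameGraph

variable (G : GameGraph)

/-- Alice can force a win from the state `v`. -/
inductive AliceWinsFrom (x : G.Outcome → Bool) : G.V → Prop
  | final (v : G.Outcome) (h : x v = false) : AliceWinsFrom x v.1
  | alice (v : G.Interior) (h : G.turn v = .alice) (w : G.V) (hw : G.Adj v.1 w)
      (ih : AliceWinsFrom x w) : AliceWinsFrom x v.1
  | bob (v : G.Interior) (h : G.turn v = .bob) (ih : ∀ w, G.Adj v.1 w → AliceWinsFrom x w) :
      AliceWinsFrom x v.1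

variable {G}

theorem AliceWinsFrom.exists_of_alice {x : G.Outcome → Bool} {v : G.Interior}
    (hv : G.turn v = .alice) (hx : G.AliceWinsFrom x v.1) :
    ∃ w, G.Adj v.1 w ∧ G.AliceWinsFrom x w := by
  generalize hu : v.1 = u at hx
  cases hx with
  | final u' _ => exact (u'.2 (hu ▸ v.2)).elim
  | alice u' _ w hw ih => exact ⟨w, hw, ih⟩
  | bob u' h' _ =>
    obtain rfl := Subtype.ext hu
    simp_all

theorem AliceWinsFrom.of_adj_of_bob {x : G.Outcome → Bool} {v : G.Interior}
    (hv : G.turn v = .bob) (hx : G.AliceWinsFrom x v.1) {w : G.V} (hw : G.Adj v.1 w) :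
    G.AliceWinsFrom x w := by
  generalize hu : v.1 = u at hx
  cases hx with
  | final u' _ => exact (u'.2 (hu ▸ v.2)).elim
  | alice u' h' =>
    obtain rfl := Subtype.ext hu
    simp_all
  | bob u' _ h =>
    rw [hu] at hw
    exact h w hw

theorem AliceWinsFrom.eq_false {x : G.Outcome → Bool} {v : G.Outcome}
    (hx : G.AliceWinsFrom x v.1) : x v = false := by
  generalize hu : v.1 = u at hx
  cases hx with
  | final u' h => rwa [Subtype.ext hu]
  | alice u' => exact (v.2 (hu ▸ u'.2)).elim
  | bob u' => exact (v.2 (hu ▸ u'.2)).elim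

theorem next_of_alice (s₁ : G.Strategy .alice) (s₂ : G.Strategy .bob) {v : G.Interior}
    (h : G.turn v = .alice) : G.next s₁ s₂ v = s₁ v h := by
  unfold next
  split
  · rfl
  · next h' => exact absurd (h.symm.trans h') (by simp)

theorem next_of_bob (s₁ : G.Strategy .alice) (s₂ : G.Strategy .bob) {v : G.Interior}
    (h : G.turn v = .bob) : G.next s₁ s₂ v = s₂ v h := by
  unfold next
  split
  · next h' => exact absurd (h.symm.trans h') (by simp)
  · rfl

theorem outcomeFrom_outcome (s₁ : G.Strategy .alice) (s₂ : G.Strategy .bob) (v : G.Outcome) :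
    G.outcomeFrom s₁ s₂ v.1 = v := by
  rw [outcomeFrom, WellFounded.fix_eq, dif_neg v.2]

theorem outcomeFrom_interior (s₁ : G.Strategy .alice) (s₂ : G.Strategy .bob) (v : G.Interior) :
    G.outcomeFrom s₁ s₂ v.1 = G.outcomeFrom s₁ s₂ (G.next s₁ s₂ v).1 := by
  rw [outcomeFrom, WellFounded.fix_eq, dif_pos v.2]

/-- One positional strategy serves all winning states at once: move to a winning successor if there
is one, and arbitrarily otherwise. -/
theorem exists_alice_strategy (x : G.Outcome → Bool) :
    ∃ s₁ : G.Strategy .alice, ∀ (s₂ : G.Strategy .bob) (v : G.V),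
      G.AliceWinsFrom x v → x (G.outcomeFrom s₁ s₂ v) = false := by
  have hs : ∀ v : G.Interior, G.turn v = .alice → ∃ w : {w : G.V // G.Adj v.1 w},
      G.AliceWinsFrom x v.1 → G.AliceWinsFrom x w.1 := by
    intro v hv
    by_cases h : ∃ w : {w : G.V // G.Adj v.1 w}, G.AliceWinsFrom x w.1
    · exact h.imp fun w hw _ => hw
    · obtain ⟨w, hw⟩ := v.2
      refine ⟨⟨w, hw⟩, fun hx => (h ?_).elim⟩
      obtain ⟨w, hw, hxw⟩ := hx.exists_of_alice hv
      exact ⟨⟨w, hw⟩, hxw⟩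
  choose s hs using hs
  refine ⟨s, fun s₂ v hv => ?_⟩
  induction v using G.wellFounded_adj.induction with
  | _ v ih =>
    by_cases hint : ∃ w, G.Adj v w
    · rw [outcomeFrom_interior s s₂ ⟨v, hint⟩]
      refine ih _ (G.next s s₂ ⟨v, hint⟩).2 ?_
      rcases ht : G.turn ⟨v, hint⟩ with _ | _
      · rw [next_of_alice _ _ ht]
        exact hs _ ht hv
      · exact hv.of_adj_of_bob ht (G.next s s₂ _).2
    · rw [outcomeFrom_outcome s s₂ ⟨v, hint⟩]
      exact AliceWinsFrom.eq_false (v := ⟨v, hint⟩) hv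

/-- Where Alice cannot force a win, none of her moves can change this, and on his turn Bob has a
move that preserves it, up to a final state that is his. -/
theorem exists_bob_strategy (x : G.Outcome → Bool) :
    ∃ s₂ : G.Strategy .bob, ∀ (s₁ : G.Strategy .alice) (v : G.V),
      ¬ G.AliceWinsFrom x v → x (G.outcomeFrom s₁ s₂ v) = true := by
  have hs : ∀ v : G.Interior, G.turn v = .bob → ∃ w : {w : G.V // G.Adj v.1 w},
      ¬ G.AliceWinsFrom x v.1 → ¬ G.AliceWinsFrom x w.1 := by
    intro v hv
    by_cases h : ∃ w : {w : G.V // G.Adj v.1 w}, ¬ G.AliceWinsFrom x w.1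
    · exact h.imp fun w hw _ => hw
    · push Not at h
      obtain ⟨w, hw⟩ := v.2
      exact ⟨⟨w, hw⟩, fun hx => (hx (.bob v hv fun w hw => h ⟨w, hw⟩)).elim⟩
  choose s hs using hs
  refine ⟨s, fun s₁ v hv => ?_⟩
  induction v using G.wellFounded_adj.induction with
  | _ v ih =>
    by_cases hint : ∃ w, G.Adj v w
    · rw [outcomeFrom_interior s₁ s ⟨v, hint⟩]
      refine ih _ (G.next s₁ s ⟨v, hint⟩).2 ?_
      rcases ht : G.turn ⟨v, hint⟩ with _ | _
      · exact fun h => hv (.alice ⟨v, hint⟩ ht _ (G.next s₁ s ⟨v, hint⟩).2 h)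
      · rw [next_of_bob _ _ ht]
        exact hs _ ht hv
    · rw [outcomeFrom_outcome s₁ s ⟨v, hint⟩]
      by_contra h
      exact hv (.final ⟨v, hint⟩ (by simpa using h))

theorem aliceWins_iff (x : G.Outcome → Bool) : G.AliceWins x ↔ G.AliceWinsFrom x G.root := by
  refine ⟨fun ⟨s₁, hs₁⟩ => ?_, fun h => ?_⟩
  · by_contra h
    obtain ⟨s₂, hs₂⟩ := exists_bob_strategy x
    exact Bool.false_ne_true ((hs₁ s₂).symm.trans (hs₂ s₁ _ h))
  · obtain ⟨s₁, hs₁⟩ := exists_alice_strategy x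
    exact ⟨s₁, fun s₂ => hs₁ s₂ _ h⟩

theorem bobWins_iff (x : G.Outcome → Bool) : G.BobWins x ↔ ¬ G.AliceWinsFrom x G.root := by
  refine ⟨fun ⟨s₂, hs₂⟩ h => ?_, fun h => ?_⟩
  · obtain ⟨s₁, hs₁⟩ := exists_alice_strategy x
    exact Bool.false_ne_true ((hs₁ s₂ _ h).symm.trans (hs₂ s₁))
  · obtain ⟨s₂, hs₂⟩ := exists_bob_strategy x
    exact ⟨s₂, fun s₁ => hs₂ s₁ _ h⟩

theorem isProbabilityMeasure_winnerLaw (p : unitInterval) :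
    IsProbabilityMeasure (G.winnerLaw p) := by
  unfold winnerLaw
  infer_instance

/-- By determinacy the two events are complementary; they are measurable since there are finitely
many assignments. -/
theorem probAlice_eq (p : unitInterval) : G.probAlice p = 1 - G.probBob p := by
  have := G.finite
  have := isProbabilityMeasure_winnerLaw (G := G) p
  have e : {x | G.AliceWins x} = {x | G.BobWins x}ᶜ := by
    ext x
    simp [aliceWins_iff, bobWins_iff]
  rw [probAlice, probBob, e, probReal_compl_eq_one_sub (Set.toFinite _).measurableSet]

theorem probBob_le_one (p : unitInterval) : G.probBob p ≤ 1 := by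
  have := isProbabilityMeasure_winnerLaw (G := G) p
  exact measureReal_le_one

theorem ofReal_one_sub_probBob (p : unitInterval) :
    ENNReal.ofReal (1 - G.probBob p) = G.winnerLaw p {x | G.AliceWinsFrom x G.root} := by
  have := isProbabilityMeasure_winnerLaw (G := G) p
  rw [← probAlice_eq, probAlice, ofReal_measureReal]
  simp only [aliceWins_iff]

end GameGraph

/-! ### Contours of outcomes won by Alice -/

namespace DecisionGraph

/-- The vertices at the same distance from the root as `a` that share with `a` an ancestor `b`
steps below. -/
def relatives (D : DecisionGraph) (a : D.V) (b : ℕ) : Set D.V :=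
  {a' | D.len a' = D.len a ∧ ∃ u, D.len u + b = D.len a ∧
    Relation.ReflTransGen D.Adj u a ∧ Relation.ReflTransGen D.Adj u a'}

theorem len_le_of_reflTransGen (D : DecisionGraph) {u v : D.V}
    (h : Relation.ReflTransGen D.Adj u v) : D.len u ≤ D.len v := by
  induction h with
  | refl => rfl
  | tail _ h ih => have := D.len_succ h; omega

theorem finite_relatives (D : DecisionGraph) (a : D.V) (b : ℕ) : (D.relatives a b).Finite :=
  (D.finite_len_le (D.len a)).subset fun _ h => h.1.le

section Game

variable {D : DecisionGraph} {n : ℕ}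

/-- What is recorded of the moves of Alice in an outcome. -/
def alicePart (o : ((D.ltimes quadrant).game (2 * n)).Outcome) : D.V := o.1.1.1.1

/-- The number of times that Bob has played his first possible move. -/
def bobCount (o : ((D.ltimes quadrant).game (2 * n)).Outcome) : ℕ := o.1.1.1.2.1

/-- Every vertex of a decision graph has a successor, so play stops only at length `2 * n`. There
parity leaves only the case in which both players have moved `n` times. -/
theorem len_of_outcome (o : ((D.ltimes quadrant).game (2 * n)).Outcome) :
    D.len (alicePart o) = n ∧ bobCount o + o.1.1.1.2.2 = n := by
  obtain ⟨⟨v, hv⟩, ho⟩ := o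
  have hlen : (D.ltimes quadrant).len v = 2 * n := by
    refine le_antisymm hv (not_lt.1 fun h => ho ?_)
    obtain ⟨w, hw⟩ := (D.ltimes quadrant).exists_adj v
    exact ⟨⟨w, by rw [(D.ltimes quadrant).len_succ hw]; exact h⟩, hw⟩
  have h₁ : D.len v.1.1 + (v.1.2.1 + v.1.2.2) = 2 * n := hlen
  have h₂ : D.len v.1.1 = v.1.2.1 + v.1.2.2 ∨ D.len v.1.1 = v.1.2.1 + v.1.2.2 + 1 := v.2
  simp only [alicePart, bobCount]
  omega

theorem outcome_ext {o o' : ((D.ltimes quadrant).game (2 * n)).Outcome}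
    (ha : alicePart o = alicePart o') (hb : bobCount o = bobCount o') : o = o' := by
  have h₁ := (len_of_outcome o).2
  have h₂ := (len_of_outcome o').2
  refine Subtype.ext (Subtype.ext (Subtype.ext (Prod.ext ha (Prod.ext hb ?_))))
  omega

/-- The relation between outcomes that connects the outcomes visited by a contour: the histories
of Alice have a common ancestor at a distance from the final time that is one more than the
increase in the count of Bob. -/
def ContourStep (o o' : ((D.ltimes quadrant).game (2 * n)).Outcome) : Prop :=
  ∃ u, D.len u + bobCount o' + 1 = n + bobCount o ∧
    Relation.ReflTransGen D.Adj u (alicePart o) ∧ Relation.ReflTransGen D.Adj u (alicePart o')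

theorem ContourStep.bobCount_le {o o' : ((D.ltimes quadrant).game (2 * n)).Outcome}
    (h : ContourStep o o') : bobCount o ≤ bobCount o' + 1 := by
  obtain ⟨u, h, hu, -⟩ := h
  have := D.len_le_of_reflTransGen hu
  have := (len_of_outcome o).1
  omega

/-- The increment `b - 1` places the common ancestor `b` levels before the end, and fixes Bob's
count, so that only Alice's part is free. -/
theorem ncard_contourStep_le (o : ((D.ltimes quadrant).game (2 * n)).Outcome) (b : ℕ) :
    {o' | ContourStep o o' ∧ bobCount o' + 1 = bobCount o + b}.ncard ≤
      (D.relatives (alicePart o) b).ncard := by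
  refine Set.ncard_le_ncard_of_injOn alicePart ?_ ?_ (D.finite_relatives _ _)
  · rintro o' ⟨⟨u, h, hu, hu'⟩, hb⟩
    have h₁ := (len_of_outcome o).1
    have h₂ := (len_of_outcome o').1
    exact ⟨h₂.trans h₁.symm, u, by omega, hu, hu'⟩
  · rintro o₁ ⟨-, h₁⟩ o₂ ⟨-, h₂⟩ h
    exact outcome_ext h (by omega)

theorem ncard_bobCount_eq_le {c : ℕ} (hD : ∀ a b, (D.relatives a b).ncard ≤ c ^ b) :
    {o : ((D.ltimes quadrant).game (2 * n)).Outcome | bobCount o = n}.ncard ≤ c ^ n := by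
  rcases Set.eq_empty_or_nonempty
    {o : ((D.ltimes quadrant).game (2 * n)).Outcome | bobCount o = n} with h | ⟨o, -⟩
  · simp [h]
  · refine le_trans ?_ (hD (alicePart o) n)
    refine Set.ncard_le_ncard_of_injOn alicePart ?_ ?_ (D.finite_relatives _ _)
    · intro o' _
      have h₁ := (len_of_outcome o).1
      have h₂ := (len_of_outcome o').1
      -- All vertices at distance `n` are relatives through the root, `n` levels up.
      exact ⟨h₂.trans h₁.symm, D.root, by rw [D.len_root]; omega, D.reach _, D.reach _⟩
    · rintro o₁ h₁ o₂ h₂ h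
      exact outcome_ext h (h₁.trans h₂.symm)

/-- Alice can force a win from the state in which `a` and `b` are recorded of the moves of Alice
and Bob. -/
def AliceWinsAt (x : ((D.ltimes quadrant).game (2 * n)).Outcome → Bool) (a : D.V) (b : ℕ × ℕ) :
    Prop :=
  ∃ v : ((D.ltimes quadrant).game (2 * n)).V, v.1.1 = (a, b) ∧
    ((D.ltimes quadrant).game (2 * n)).AliceWinsFrom x v

variable {x : ((D.ltimes quadrant).game (2 * n)).Outcome → Bool}

theorem AliceWinsAt.exists_outcome {a : D.V} {b : ℕ × ℕ} (h : AliceWinsAt x a b)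
    (ha : D.len a = n) (hb : b.1 + b.2 = n) :
    ∃ o, alicePart o = a ∧ bobCount o = b.1 ∧ x o = false := by
  obtain ⟨v, hv, hx⟩ := h
  have hfin : ¬ ∃ w, ((D.ltimes quadrant).game (2 * n)).Adj v w := by
    rintro ⟨w, hw⟩
    have h₁ := (D.ltimes quadrant).len_succ hw
    have h₂ : (D.ltimes quadrant).len v.1 = D.len v.1.1.1 + (v.1.1.2.1 + v.1.1.2.2) := rfl
    have h₃ : (D.ltimes quadrant).len w.1 ≤ 2 * n := w.2
    rw [hv] at h₂
    simp only at h₂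
    omega
  refine ⟨⟨v, hfin⟩, congrArg Prod.fst hv, congrArg (fun z => z.2.1) hv, ?_⟩
  exact GameGraph.AliceWinsFrom.eq_false (v := ⟨v, hfin⟩) hx

theorem AliceWinsAt.bob_move {a : D.V} {b b' : ℕ × ℕ} (h : AliceWinsAt x a b)
    (ha : D.len a = b.1 + b.2 + 1) (hn : b.1 + b.2 < n) (hb : quadrant.Adj b b') :
    AliceWinsAt x a b' := by
  obtain ⟨⟨⟨p, hp⟩, hl⟩, rfl, hx⟩ := h
  have hb' : b'.1 + b'.2 = b.1 + b.2 + 1 := quadrant.len_succ hb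
  let w : ((D.ltimes quadrant).game (2 * n)).V :=
    ⟨⟨(a, b'), Or.inl (show D.len a = b'.1 + b'.2 by omega)⟩,
      show D.len a + (b'.1 + b'.2) ≤ 2 * n by omega⟩
  refine ⟨w, rfl, ?_⟩
  have hw : ((D.ltimes quadrant).game (2 * n)).Adj ⟨⟨(a, b), hp⟩, hl⟩ w := Or.inr ⟨ha, rfl, hb⟩
  refine GameGraph.AliceWinsFrom.of_adj_of_bob (G := (D.ltimes quadrant).game (2 * n))
    (v := ⟨⟨⟨(a, b), hp⟩, hl⟩, w, hw⟩) ?_ hx hw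
  refine if_neg ?_
  change ¬ Even (D.len a + (b.1 + b.2))
  rw [ha, Nat.not_even_iff]
  omega

theorem AliceWinsAt.alice_move {a : D.V} {b : ℕ × ℕ} (h : AliceWinsAt x a b)
    (ha : D.len a = b.1 + b.2) (hn : b.1 + b.2 < n) :
    ∃ a', D.Adj a a' ∧ AliceWinsAt x a' b := by
  obtain ⟨⟨⟨p, hp⟩, hl⟩, rfl, hx⟩ := h
  obtain ⟨a₀, ha₀⟩ := D.exists_adj a
  have hla := D.len_succ ha₀
  let w : ((D.ltimes quadrant).game (2 * n)).V :=
    ⟨⟨(a₀, b), Or.inr (show D.len a₀ = b.1 + b.2 + 1 by omega)⟩,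
      show D.len a₀ + (b.1 + b.2) ≤ 2 * n by omega⟩
  have hw : ((D.ltimes quadrant).game (2 * n)).Adj ⟨⟨(a, b), hp⟩, hl⟩ w :=
    Or.inl ⟨ha, ha₀, rfl⟩
  obtain ⟨w', hw', hx'⟩ := GameGraph.AliceWinsFrom.exists_of_alice
    (G := (D.ltimes quadrant).game (2 * n)) (v := ⟨⟨⟨(a, b), hp⟩, hl⟩, w, hw⟩)
    (if_pos (show Even (D.len a + (b.1 + b.2)) from
      ha ▸ Even.add_self _)) hx
  rcases hw' with ⟨-, h₁, h₂⟩ | ⟨h₁, -⟩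
  · exact ⟨w'.1.1.1, h₁, w', Prod.ext rfl h₂, hx'⟩
  · have h₁ : D.len a = b.1 + b.2 + 1 := h₁
    omega

/-- With `k` rounds left, Bob's count can end anywhere from `i` to `i + k`; the contour joins these
extremes. That its ends descend from `a` is carried along to provide the common ancestor when two
contours are glued. -/
theorem AliceWinsAt.exists_contour (k : ℕ) {a : D.V} {i j : ℕ} (h : AliceWinsAt x a (i, j))
    (ha : D.len a = i + j) (hk : i + j + k = n) :
    ∃ u v, bobCount u = i + k ∧ bobCount v = i ∧ x v = false ∧
      Relation.ReflTransGen D.Adj a (alicePart u) ∧ Relation.ReflTransGen D.Adj a (alicePart v) ∧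
      Relation.ReflTransGen (fun u v => ContourStep u v ∧ x u = false) u v := by
  induction k generalizing a i j with
  | zero =>
    obtain ⟨o, rfl, h₁, h₂⟩ := h.exists_outcome (by omega) (by simpa using hk)
    exact ⟨o, o, h₁, h₁, h₂, .refl, .refl, .refl⟩
  | succ k ih =>
    obtain ⟨a', haa', h'⟩ := h.alice_move ha (by simp only; omega)
    have hl := D.len_succ haa'
    obtain ⟨u₁, v₁, hu₁, hv₁, hx₁, hau₁, hav₁, huv₁⟩ := ih (i := i + 1) (j := j)
      (h'.bob_move (by simp only; omega) (by simp only; omega) (Or.inl rfl)) (by omega) (by omega)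
    obtain ⟨u₂, v₂, hu₂, hv₂, hx₂, hau₂, hav₂, huv₂⟩ := ih (i := i) (j := j + 1)
      (h'.bob_move (by simp only; omega) (by simp only; omega) (Or.inr rfl)) (by omega) (by omega)
    -- The junction goes from `v₁`, with count `i + 1`, to `u₂`, with count `i + k`; their ancestor
    -- `a'` lies `k` levels before the end, as `ContourStep` requires.
    exact ⟨u₁, v₂, by omega, hv₂, hx₂, .head haa' hau₁, .head haa' hav₂,
      (huv₁.tail ⟨⟨a', by omega, hav₁, hau₂⟩, hx₁⟩).trans huv₂⟩

theorem ofReal_one_sub_probBob_le {c : ℕ} (hc : 0 < c)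
    (hD : ∀ a b, (D.relatives a b).ncard ≤ c ^ b) (p : unitInterval) :
    ENNReal.ofReal (1 - ((D.ltimes quadrant).game (2 * n)).probBob p) ≤
      ∑' m : {m : ℕ // n ≤ m},
        ENNReal.ofReal ((4 * c : ℝ) ^ (m : ℕ) * (1 - (p : ℝ)) ^ ((m : ℕ) + 1)) := by
  have := ((D.ltimes quadrant).game (2 * n)).finite
  let _ : Fintype ((D.ltimes quadrant).game (2 * n)).Outcome := Fintype.ofFinite _
  rw [GameGraph.ofReal_one_sub_probBob]
  refine pi_bernoulli_exists_path_le (h := bobCount) (R := ContourStep) hc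
    (fun _ _ h => h.bobCount_le) (fun o b => (ncard_contourStep_le o b).trans (hD _ _))
    (ncard_bobCount_eq_le hD) p _ fun x hx => ?_
  have h₀ : AliceWinsAt x D.root (0, 0) := ⟨_, rfl, hx⟩
  obtain ⟨u, v, hu, hv, hxv, -, -, huv⟩ := h₀.exists_contour n D.len_root (by simp)
  exact ⟨u, v, by simpa using hu, hv, hxv, huv⟩

end Game

/-! ### Counting relatives in the tree and in the quadrant -/

/-- The ancestor is the unique prefix of `a` with the last `b` letters removed, and a relative is
this prefix followed by `b` free letters. -/
theorem ncard_relatives_tree_le (a : tree.V) (b : ℕ) : (tree.relatives a b).ncard ≤ 2 ^ b := by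
  change List Bool at a
  have key : ∀ u v : List Bool, Relation.ReflTransGen tree.Adj u v → ∃ l, v = u ++ l := by
    intro u v h
    induction h with
    | refl => exact ⟨[], by simp⟩
    | tail _ h ih =>
      obtain ⟨l, rfl⟩ := ih
      obtain ⟨k, rfl⟩ := h
      exact ⟨l ++ [k], by simp⟩
  have hsub : tree.relatives a b ⊆
      (fun l : List.Vector Bool b => List.take (List.length a - b) a ++ l.1) '' Set.univ := by
    rintro a' ⟨hlen, (u : List Bool), hu, h₁, h₂⟩
    obtain ⟨l₁, rfl⟩ := key _ _ h₁
    obtain ⟨l₂, rfl⟩ := key _ _ h₂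
    have hu' : List.length u + b = List.length (u ++ l₁) := hu
    have hlen' : List.length (u ++ l₂) = List.length (u ++ l₁) := hlen
    simp only [List.length_append] at hu' hlen'
    refine ⟨⟨l₂, by omega⟩, trivial, ?_⟩
    have : List.length (u ++ l₁) - b = u.length := by rw [List.length_append]; omega
    simp only [this, List.take_left]
    rfl
  calc (tree.relatives a b).ncard ≤ _ := Set.ncard_le_ncard hsub (Set.finite_univ.image _)
    _ ≤ Nat.card (List.Vector Bool b) := by
        rw [← Set.ncard_univ]
        exact Set.ncard_image_le
    _ = 2 ^ b := by simp

/-- Relatives lie on the same antidiagonal and their first coordinates differ by at most `b`. This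
leaves `2 * b + 1` candidates; the base 4 is what produces `2 ^ 4 = 4 * c`. -/
theorem ncard_relatives_quadrant_le (a : quadrant.V) (b : ℕ) :
    (quadrant.relatives a b).ncard ≤ 4 ^ b := by
  have key : ∀ u v : ℕ × ℕ, Relation.ReflTransGen quadrant.Adj u v → u.1 ≤ v.1 ∧ u.2 ≤ v.2 := by
    intro u v h
    induction h with
    | refl => simp
    | tail _ h ih => rcases h with rfl | rfl <;> simp only <;> omega
  have hmaps : ∀ a' ∈ quadrant.relatives a b,
      (a'.1 : ℕ) ∈ (Finset.Icc (a.1 - b) (a.1 + b) : Finset ℕ) := by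
    rintro a' ⟨hlen, u, hu, h₁, h₂⟩
    have h₁ := key _ _ h₁
    have h₂ := key _ _ h₂
    have hlen : a'.1 + a'.2 = a.1 + a.2 := hlen
    have hu : u.1 + u.2 + b = a.1 + a.2 := hu
    rw [Finset.mem_Icc]
    omega
  have hinj : Set.InjOn (fun a' : ℕ × ℕ => a'.1) (quadrant.relatives a b) := by
    rintro a₁ ⟨h₁, -⟩ a₂ ⟨h₂, -⟩ h
    have h₁ : a₁.1 + a₁.2 = a.1 + a.2 := h₁
    have h₂ : a₂.1 + a₂.2 = a.1 + a.2 := h₂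
    simp only at h
    exact Prod.ext h (by omega)
  calc (quadrant.relatives a b).ncard
      ≤ ((Finset.Icc (a.1 - b) (a.1 + b) : Finset ℕ) : Set ℕ).ncard :=
        Set.ncard_le_ncard_of_injOn _ hmaps hinj (Finset.finite_toSet _)
    _ ≤ 2 * b + 1 := by
        rw [Set.ncard_coe_finset, Nat.card_Icc]
        omega
    _ ≤ 4 ^ b := by
        have : ∀ b : ℕ, 2 * b + 1 ≤ 4 ^ b := fun b => by
          induction b with
          | zero => simp
          | succ b ih => rw [pow_succ]; omega
        exact this b

end DecisionGraph

/-! ### Vanishing tails and the conclusion -/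

theorem tendsto_tsum_tail_atTop_zero {f : ℕ → ENNReal} (hf : ∑' m, f m ≠ ⊤) :
    Filter.Tendsto (fun n : ℕ => ∑' m : {m : ℕ // n ≤ m}, f m) Filter.atTop (nhds 0) := by
  refine ((ENNReal.tendsto_tsum_compl_atTop_zero hf).comp
    Filter.tendsto_finset_range).congr fun n => ?_
  have e : {m : ℕ | m ∉ Finset.range n} = {m | n ≤ m} := by
    ext m
    simp
  exact congrArg (fun s : Set ℕ => ∑' m : s, f m) e

theorem tendsto_one_of_ofReal_one_sub_le {P : ℕ → ℝ} {C q : ℝ} (hC : 0 ≤ C) (hq : 0 ≤ q)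
    (hCq : C * q < 1) (hP : ∀ n, P n ≤ 1)
    (h : ∀ n, ENNReal.ofReal (1 - P n) ≤
      ∑' m : {m : ℕ // n ≤ m}, ENNReal.ofReal (C ^ (m : ℕ) * q ^ ((m : ℕ) + 1))) :
    Filter.Tendsto P Filter.atTop (nhds 1) := by
  have hsum : Summable fun m : ℕ => C ^ m * q ^ (m + 1) := by
    refine ((summable_geometric_of_lt_one (mul_nonneg hC hq) hCq).mul_right q).congr fun m => ?_
    rw [mul_pow]
    ring
  have h₀ := tendsto_of_tendsto_of_tendsto_of_le_of_le tendsto_const_nhds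
    (tendsto_tsum_tail_atTop_zero hsum.tsum_ofReal_ne_top) (fun _ => zero_le) h
  have h₁ := (ENNReal.tendsto_toReal ENNReal.zero_ne_top).comp h₀
  have h₂ : Filter.Tendsto (fun n => 1 - P n) Filter.atTop (nhds 0) := by
    refine h₁.congr fun n => ?_
    simp [ENNReal.toReal_ofReal (sub_nonneg.2 (hP n))]
  simpa using h₂.const_sub 1

theorem ofReal_one_sub_probBob_gameAb_le (n : ℕ) (p : unitInterval) :
    ENNReal.ofReal (1 - (gameAb n).probBob p) ≤
      ∑' m : {m : ℕ // n ≤ m},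
        ENNReal.ofReal (2 ^ (3 * (m : ℕ)) * (1 - (p : ℝ)) ^ ((m : ℕ) + 1)) := by
  have h := DecisionGraph.ofReal_one_sub_probBob_le (n := n) two_pos
    DecisionGraph.ncard_relatives_tree_le p
  have e : (4 * (2 : ℕ) : ℝ) = 2 ^ 3 := by norm_num
  simp only [e, ← pow_mul] at h
  exact h

theorem ofReal_one_sub_probBob_gameab_le (n : ℕ) (p : unitInterval) :
    ENNReal.ofReal (1 - (gameab n).probBob p) ≤
      ∑' m : {m : ℕ // n ≤ m},
        ENNReal.ofReal (2 ^ (4 * (m : ℕ)) * (1 - (p : ℝ)) ^ ((m : ℕ) + 1)) := by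
  have h := DecisionGraph.ofReal_one_sub_probBob_le (n := n) four_pos
    DecisionGraph.ncard_relatives_quadrant_le p
  have e : (4 * (4 : ℕ) : ℝ) = 2 ^ 4 := by norm_num
  simp only [e, ← pow_mul] at h
  exact h

theorem proposition2p7 :
    (∀ n : ℕ, 1 ≤ n → ∀ p : unitInterval,
      ((gameAb n).probAlice p = 1 - (gameAb n).probBob p ∧
        ENNReal.ofReal (1 - (gameAb n).probBob p) ≤
          ∑' m : {m : ℕ // n ≤ m}, ENNReal.ofReal (2 ^ (3 * (m : ℕ)) * (1 - (p : ℝ)) ^ ((m : ℕ) + 1))) ∧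
      ((gameab n).probAlice p = 1 - (gameab n).probBob p ∧
        ENNReal.ofReal (1 - (gameab n).probBob p) ≤
          ∑' m : {m : ℕ // n ≤ m}, ENNReal.ofReal (2 ^ (4 * (m : ℕ)) * (1 - (p : ℝ)) ^ ((m : ℕ) + 1)))) ∧
    (∀ p : unitInterval, 7 / 8 < (p : ℝ) →
      Filter.Tendsto (fun n : ℕ => (gameAb n).probBob p) Filter.atTop (nhds 1)) ∧
    (∀ p : unitInterval, 15 / 16 < (p : ℝ) →
      Filter.Tendsto (fun n : ℕ => (gameab n).probBob p) Filter.atTop (nhds 1)) := by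
  refine ⟨fun n _ p => ⟨⟨GameGraph.probAlice_eq p, ofReal_one_sub_probBob_gameAb_le n p⟩,
    GameGraph.probAlice_eq p, ofReal_one_sub_probBob_gameab_le n p⟩, fun p hp => ?_, fun p hp => ?_⟩
  -- The geometric ratio `8 * (1 - p)` is below one exactly when `p > 7 / 8`; in the second case it
  -- is `16 * (1 - p)`.
  · refine tendsto_one_of_ofReal_one_sub_le (C := 2 ^ 3) (q := 1 - p) (by norm_num)
      (by linarith [p.2.2]) (by linarith) (fun n => GameGraph.probBob_le_one p) fun n => ?_
    simpa only [← pow_mul] using ofReal_one_sub_probBob_gameAb_le n p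
  · refine tendsto_one_of_ofReal_one_sub_le (C := 2 ^ 4) (q := 1 - p) (by norm_num)
      (by linarith [p.2.2]) (by linarith) (fun n => GameGraph.probBob_le_one p) fun n => ?_
    simpa only [← pow_mul] using ofReal_one_sub_probBob_gameab_le n p
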